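/- Let $B=(b_{ij})$ be an $n\times n$ integer matrix and $d_1,\dots,d_n$ positive integers such that $DB$ is skew-symmetric, where $D=\operatorname{diag}(d_1,\dots,d_n)$; put $\mathbf d=(d_1,\dots,d_n)$. Let $\Lambda$ be a skew-symmetric $n\times n$ integer matrix, $t_0$ a vertex of the $n$-regular tree $\mathbb T_n$, and let $\mathcal A_\bullet$ be the quantum cluster algebra (in the sense of Berenstein and Zelevinsky) with principal coefficients at $t_0$: its initial extended exchange matrix is the $2n\times n$ matrix $\tilde B=\binom{B}{I}$, with columns $\tilde{\mathbf b}^1,\dots,\tilde{\mathbf b}^n$, and its initial toric frame $M_0$ satisfies $M_0(\mathbf c)M_0(\mathbf c')=q^{\Lambda_0(\mathbf c,\mathbf c')/2}M_0(\mathbf c+\mathbf c')$, where $\Lambda_0$ is the skew-symmetric $2n\times 2n$ integer matrix with upper left block $\Lambda$ and $\tilde B^T\Lambda_0=(D\,|\,0)$. For $j\in[1,n]$ and $t\in\mathbb T_n$ let $X_{j;t}$ be the corresponding quantum cluster variable, and let $\mathbf g_{j;t}\in\mathbb Z^n$ be the $\mathbf g$-vector, i.e. the degree of the corresponding cluster variable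 of the classical cluster algebra with principal coefficients at $t_0$, for the $\mathbb Z^n$-grading of $\mathbb Z[x_1^{\pm1},\dots,x_n^{\pm1},y_1^{\pm1},\dots,y_n^{\pm1}]$ with $\deg x_i=\mathbf e_i$ and $\deg y_i=-(\text{the }i\text{th column of }B)$. Let $R$ be the algebra of Laurent polynomials over $\mathbb Z[q^{\pm1/2}]$ in $Z_1,\dots,Z_n$ with $Z_iZ_k=q^{d_ib_{ik}}Z_kZ_i$, with basis the normalized monomials $Z^{\mathbf a}=q^{\frac12\sum_{i<k}d_kb_{ki}a_ia_k}Z_1^{a_1}\cdots Z_n^{a_n}$, $\mathbf a\in\mathbb Z^n$. The quantum $F$-polynomial $F_{j;t}\in R$ is the unique polynomial in $Z_1,\dots,Z_n$ with coefficients in $\mathbb Z[q^{\pm1/2}]$ such that $X_{j;t}=F_{j;t}(\hat Y_1,\dots,\hat Y_n)\,M_0(\mathbf g_{j;t})$, where $\hat Y_i=M_0(\tilde{\mathbf b}^i)$ and $\mathbf g_{j;t}$ is extended by $n$ zeros to a vector of $\mathbb Z^{2n}$. Let $j\in[1,n]$, $t\in\mathbb T_n$ and $\mathbf a\in\mathbb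 Z^n$, and let $P_{\mathbf a}\in\mathbb Z[x,x^{-1}]$ be such that $P_{\mathbf a}(q^{1/2})$ is the coefficient of $Z^{\mathbf a}$ in $F_{j;t}$. Write $\mathbf g_{j;t}\cdot\mathbf a\cdot\mathbf d=\sum_{i=1}^n g_ia_id_i$, where $\mathbf g_{j;t}=(g_1,\dots,g_n)$. Then $$P_{\mathbf a}(q^{1/2})=q^{-\mathbf g_{j;t}\cdot\mathbf a\cdot\mathbf d}\,P_{\mathbf a}(q^{-1/2}).$$ In particular, if $P_{\mathbf a}(q^{1/2})=q^{c}$ for some $c\in\frac12\mathbb Z$, then $c=-\dfrac{\mathbf g_{j;t}\cdot\mathbf a\cdot\mathbf d}{2}$. -/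

import Mathlib

open scoped LaurentPolynomial Matrix nonZeroDivisors

noncomputable section

namespace QuantumCluster

/-! ### Based quantum tori and their skew-fields of fractions

The coefficient ring `ℤ[q^{±1/2}]` is `ℤ[T;T⁻¹]`, the variable `T` being `q^{1/2}`; thus `q^{s/2}` is
`LaurentPolynomial.T s`. -/

section Torus

variable {σ : Type} [Fintype σ]

/-- The bilinear form on `ℤ^σ` with matrix `Λ`. -/
def form (Λ : Matrix σ σ ℤ) (e f : σ → ℤ) : ℤ := ∑ i, ∑ j, e i * Λ i j * f j

lemma form_add_left (Λ : Matrix σ σ ℤ) (e f g : σ → ℤ) :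
    form Λ (e + f) g = form Λ e g + form Λ f g := by
  simp [form, add_mul, Finset.sum_add_distrib]

lemma form_add_right (Λ : Matrix σ σ ℤ) (e f g : σ → ℤ) :
    form Λ e (f + g) = form Λ e f + form Λ e g := by
  simp [form, mul_add, Finset.sum_add_distrib]

lemma form_zero_left (Λ : Matrix σ σ ℤ) (e : σ → ℤ) : form Λ 0 e = 0 := by simp [form]

lemma form_zero_right (Λ : Matrix σ σ ℤ) (e : σ → ℤ) : form Λ e 0 = 0 := by simp [form]

/-- The product on the free `ℤ[q^{±1/2}]`-module with basis `X^e`, `e ∈ ℤ^σ`, that is bilinear and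
satisfies `X^e X^f = q^{Λ(e,f)/2} X^{e+f}`. -/
def twistedMul (Λ : Matrix σ σ ℤ) (f g : (σ → ℤ) →₀ ℤ[T;T⁻¹]) : (σ → ℤ) →₀ ℤ[T;T⁻¹] :=
  f.sum fun e a => g.sum fun e' b =>
    Finsupp.single (e + e') (LaurentPolynomial.T (form Λ e e') * a * b)

section TwistedMul

variable (Λ : Matrix σ σ ℤ) (f g h : (σ → ℤ) →₀ ℤ[T;T⁻¹])

lemma twistedMul_zero_left : twistedMul Λ 0 f = 0 := Finsupp.sum_zero_index

lemma twistedMul_zero_right : twistedMul Λ f 0 = 0 := by simp [twistedMul]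

lemma twistedMul_add_right : twistedMul Λ f (g + h) = twistedMul Λ f g + twistedMul Λ f h := by
  simp only [twistedMul]
  rw [← Finsupp.sum_add]
  congr 1
  funext e a
  exact Finsupp.sum_add_index' (fun e' => by simp) (fun e' b c => by simp [mul_add])

lemma twistedMul_add_left : twistedMul Λ (f + g) h = twistedMul Λ f h + twistedMul Λ g h := by
  simp only [twistedMul]
  refine Finsupp.sum_add_index' (fun e => by simp) (fun e a b => ?_)
  rw [← Finsupp.sum_add]
  congr 1
  funext e' c
  rw [mul_add, add_mul, Finsupp.single_add]

lemma twistedMul_single (e e' : σ → ℤ) (a b : ℤ[T;T⁻¹]) :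
    twistedMul Λ (Finsupp.single e a) (Finsupp.single e' b) =
      Finsupp.single (e + e') (LaurentPolynomial.T (form Λ e e') * a * b) := by
  simp only [twistedMul]
  rw [Finsupp.sum_single_index, Finsupp.sum_single_index] <;> simp

lemma twistedMul_assoc :
    twistedMul Λ (twistedMul Λ f g) h = twistedMul Λ f (twistedMul Λ g h) := by
  induction f using Finsupp.induction_linear with
  | zero => simp only [twistedMul_zero_left]
  | add f f' hf hf' => simp only [twistedMul_add_left, hf, hf']
  | single e a =>
    induction g using Finsupp.induction_linear with
    | zero => simp only [twistedMul_zero_left, twistedMul_zero_right]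
    | add g g' hg hg' => simp only [twistedMul_add_left, twistedMul_add_right, hg, hg']
    | single e' b =>
      induction h using Finsupp.induction_linear with
      | zero => simp only [twistedMul_zero_right]
      | add h h' hh hh' => simp only [twistedMul_add_right, hh, hh']
      | single e'' c =>
        simp only [twistedMul_single, form_add_left, form_add_right, LaurentPolynomial.T_add,
          add_assoc]
        congr 1
        ring

lemma twistedMul_one_left : twistedMul Λ (Finsupp.single 0 1) f = f := by
  induction f using Finsupp.induction_linear with
  | zero => exact twistedMul_zero_right Λ _
  | add f g hf hg => rw [twistedMul_add_right, hf, hg]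
  | single e a => rw [twistedMul_single, form_zero_left]; simp

lemma twistedMul_one_right : twistedMul Λ f (Finsupp.single 0 1) = f := by
  induction f using Finsupp.induction_linear with
  | zero => exact twistedMul_zero_left Λ _
  | add f g hf hg => rw [twistedMul_add_left, hf, hg]
  | single e a => rw [twistedMul_single, form_zero_right]; simp

end TwistedMul

/-- The based quantum torus of the lattice `ℤ^σ` with form `Λ`: the `ℤ[q^{±1/2}]`-algebra with
basis `X^e`, `e ∈ ℤ^σ`, and with the product `X^e X^f = q^{Λ(e,f)/2} X^{e+f}`. -/
def QuantumTorus (_Λ : Matrix σ σ ℤ) : Type := (σ → ℤ) →₀ ℤ[T;T⁻¹]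

namespace QuantumTorus

variable {Λ : Matrix σ σ ℤ}

instance : AddCommGroup (QuantumTorus Λ) :=
  inferInstanceAs (AddCommGroup ((σ → ℤ) →₀ ℤ[T;T⁻¹]))

instance : Module ℤ[T;T⁻¹] (QuantumTorus Λ) :=
  inferInstanceAs (Module ℤ[T;T⁻¹] ((σ → ℤ) →₀ ℤ[T;T⁻¹]))

instance : Nontrivial (QuantumTorus Λ) :=
  inferInstanceAs (Nontrivial ((σ → ℤ) →₀ ℤ[T;T⁻¹]))

/-- The term `a X^e`. -/
def term (Λ : Matrix σ σ ℤ) (e : σ → ℤ) (a : ℤ[T;T⁻¹]) : QuantumTorus Λ := Finsupp.single e a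

/-- The coefficient of the basis element `X^e`. -/
def coeff (f : QuantumTorus Λ) (e : σ → ℤ) : ℤ[T;T⁻¹] := (show (σ → ℤ) →₀ ℤ[T;T⁻¹] from f) e

/-- The finite set of exponents with non-zero coefficient. -/
def supp (f : QuantumTorus Λ) : Finset (σ → ℤ) := (show (σ → ℤ) →₀ ℤ[T;T⁻¹] from f).support

instance : Ring (QuantumTorus Λ) where
  __ := (inferInstance : AddCommGroup (QuantumTorus Λ))
  mul := twistedMul Λ
  one := term Λ 0 1
  zero_mul := twistedMul_zero_left Λ
  mul_zero := twistedMul_zero_right Λ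
  left_distrib := twistedMul_add_right Λ
  right_distrib := twistedMul_add_left Λ
  mul_assoc := twistedMul_assoc Λ
  one_mul := twistedMul_one_left Λ
  mul_one := twistedMul_one_right Λ

lemma term_mul_term (e f : σ → ℤ) (a b : ℤ[T;T⁻¹]) :
    term Λ e a * term Λ f b = term Λ (e + f) (LaurentPolynomial.T (form Λ e f) * a * b) :=
  twistedMul_single Λ e f a b

lemma induction_terms {p : QuantumTorus Λ → Prop} (f : QuantumTorus Λ) (h0 : p 0)
    (hadd : ∀ f g, p f → p g → p (f + g)) (hterm : ∀ e a, p (term Λ e a)) : p f :=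
  Finsupp.induction_linear (motive := p) f h0 hadd hterm

lemma coeff_term (e e' : σ → ℤ) (a : ℤ[T;T⁻¹]) [Decidable (e = e')] :
    coeff (term Λ e a) e' = if e = e' then a else 0 := by
  classical
  simp only [coeff, term, Finsupp.single_apply]

lemma coeff_sum {ι : Type*} (s : Finset ι) (f : ι → QuantumTorus Λ) (e : σ → ℤ) :
    coeff (∑ i ∈ s, f i) e = ∑ i ∈ s, coeff (f i) e :=
  Finsupp.finsetSum_apply s f e

lemma mem_supp {f : QuantumTorus Λ} {e : σ → ℤ} : e ∈ f.supp ↔ coeff f e ≠ 0 :=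
  Finsupp.mem_support_iff

lemma coeff_mul (f g : QuantumTorus Λ) (e : σ → ℤ) [DecidableEq (σ → ℤ)] :
    coeff (f * g) e = ∑ p ∈ f.supp ×ˢ g.supp, if p.1 + p.2 = e then
      LaurentPolynomial.T (form Λ p.1 p.2) * f.coeff p.1 * g.coeff p.2 else 0 := by
  change coeff (∑ e ∈ f.supp, ∑ e' ∈ g.supp,
    term Λ (e + e') (LaurentPolynomial.T (form Λ e e') * f.coeff e * g.coeff e')) e = _
  simp only [coeff_sum, coeff_term, Finset.sum_product]

instance : NoZeroDivisors (QuantumTorus Λ) where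
  eq_zero_or_eq_zero_of_mul_eq_zero := by
    classical
    intro f g hfg
    by_contra! hne
    have hf : f.supp.Nonempty := Finsupp.support_nonempty_iff.2 hne.1
    have hg : g.supp.Nonempty := Finsupp.support_nonempty_iff.2 hne.2
    obtain ⟨a, ha, b, hb, hu⟩ := UniqueSums.uniqueAdd_of_nonempty hf hg
    have h0 : coeff (f * g) (a + b) = 0 := by rw [hfg]; rfl
    rw [coeff_mul, Finset.sum_eq_single (a, b)] at h0
    · rw [if_pos rfl, mul_assoc] at h0
      have hT : (LaurentPolynomial.T (form Λ a b) : ℤ[T;T⁻¹]) ≠ 0 :=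
        (LaurentPolynomial.isUnit_T _).ne_zero
      exact (mul_ne_zero hT (mul_ne_zero (mem_supp.1 ha) (mem_supp.1 hb))) h0
    · rintro ⟨x, y⟩ hxy hne'
      rw [Finset.mem_product] at hxy
      refine if_neg fun h => hne' ?_
      obtain ⟨h1, h2⟩ := hu hxy.1 hxy.2 h
      simp only at h1 h2
      rw [h1, h2]
    · intro h
      exact absurd (Finset.mem_product.2 ⟨ha, hb⟩) h

/-- Exponents in a box. -/
def box (σ : Type) [Fintype σ] (a b : ℤ) : Finset (σ → ℤ) := by
  classical exact Fintype.piFinset fun _ => Finset.Icc a b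

lemma mem_box {a b : ℤ} {e : σ → ℤ} : e ∈ box σ a b ↔ ∀ i, a ≤ e i ∧ e i ≤ b := by
  classical simp [box]

lemma card_box (a b : ℤ) : (box σ a b).card = (b + 1 - a).toNat ^ Fintype.card σ := by
  classical simp [box]

lemma exists_box (f : QuantumTorus Λ) : ∃ L : ℕ, f.supp ⊆ box σ (-L) L := by
  classical
  refine ⟨f.supp.sup fun e => Finset.univ.sup fun i => (e i).natAbs, fun e he => ?_⟩
  rw [mem_box]
  intro i
  have h : (e i).natAbs ≤ f.supp.sup fun e => Finset.univ.sup fun i => (e i).natAbs :=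
    (Finset.le_sup (f := fun i => (e i).natAbs) (Finset.mem_univ i)).trans
      (Finset.le_sup (f := fun e : σ → ℤ => Finset.univ.sup fun i => (e i).natAbs) he)
  omega

lemma exists_growth (m L : ℕ) : ∃ N : ℕ, (N + 2 * L) ^ m < 2 * N ^ m := by
  have hlim : Filter.Tendsto (fun N : ℕ => (1 + (2 * L : ℝ) / N) ^ m) Filter.atTop
      (nhds ((1 + 0) ^ m)) :=
    (tendsto_const_nhds.add (tendsto_const_div_atTop_nhds_zero_nat _)).pow m
  have h2 : ((1 : ℝ) + 0) ^ m < 2 := by norm_num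
  obtain ⟨N, hN, hpos⟩ :=
    ((hlim.eventually (gt_mem_nhds h2)).and (Filter.eventually_gt_atTop 0)).exists
  refine ⟨N, ?_⟩
  have hN0 : (0 : ℝ) < N := by exact_mod_cast hpos
  have h3 : ((N : ℝ) + 2 * L) ^ m < 2 * (N : ℝ) ^ m := by
    have : (N : ℝ) + 2 * L = N * (1 + 2 * L / N) := by field_simp
    rw [this, mul_pow]
    linarith [mul_lt_mul_of_pos_left hN (pow_pos hN0 m)]
  exact_mod_cast h3

lemma smul_term (c : ℤ[T;T⁻¹]) (e : σ → ℤ) (a : ℤ[T;T⁻¹]) :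
    c • term Λ e a = term Λ e (c * a) := Finsupp.smul_single' c e a

lemma smul_mul' (c : ℤ[T;T⁻¹]) (f g : QuantumTorus Λ) : (c • f) * g = c • (f * g) := by
  induction f using induction_terms with
  | h0 => rw [smul_zero, zero_mul, smul_zero]
  | hadd f f' hf hf' => rw [smul_add, add_mul, hf, hf', add_mul, smul_add]
  | hterm e a =>
    induction g using induction_terms with
    | h0 => rw [mul_zero, mul_zero, smul_zero]
    | hadd g g' hg hg' => rw [mul_add, hg, hg', mul_add, smul_add]
    | hterm e' b =>
      rw [smul_term, term_mul_term, term_mul_term, smul_term]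
      congr 1
      ring

/-- The Ore condition, by comparing ranks in large boxes. -/
lemma ore (f g : QuantumTorus Λ) (hg : g ≠ 0) : ∃ u v : QuantumTorus Λ, v ≠ 0 ∧ v * f = u * g := by
  classical
  obtain ⟨L₁, h₁⟩ := exists_box f
  obtain ⟨L₂, h₂⟩ := exists_box g
  set L := max L₁ L₂ with hL
  obtain ⟨N, hN⟩ := exists_growth (Fintype.card σ) L
  have hmem : ∀ h : QuantumTorus Λ, h.supp ⊆ box σ (-L) L → ∀ e ∈ box σ 1 N,
      (term Λ e 1 * h) ∈ Submodule.span ℤ[T;T⁻¹]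
        (((box σ (1 - L) (N + L)).image fun e => term Λ e 1 : Finset (QuantumTorus Λ)) :
          Set (QuantumTorus Λ)) := by
    intro h hh e he
    have hsum : h = ∑ e' ∈ h.supp, term Λ e' (h.coeff e') := (Finsupp.sum_single h).symm
    rw [hsum, Finset.mul_sum]
    refine Submodule.sum_mem _ fun e' he' => ?_
    rw [term_mul_term, ← mul_one (_ * _ * _), ← smul_term]
    refine Submodule.smul_mem _ _ (Submodule.subset_span ?_)
    rw [Finset.mem_coe, Finset.mem_image]
    refine ⟨e + e', ?_, rfl⟩
    have hb := mem_box.1 (hh he')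
    have ha := mem_box.1 he
    refine mem_box.2 fun i => ?_
    have := hb i
    have := ha i
    simp only [Pi.add_apply]
    omega
  have hf' : f.supp ⊆ box σ (-L) L := h₁.trans fun e he => mem_box.2 fun i => by
    have := mem_box.1 he i; omega
  have hg' : g.supp ⊆ box σ (-L) L := h₂.trans fun e he => mem_box.2 fun i => by
    have := mem_box.1 he i; omega
  let v : (box σ 1 N) ⊕ (box σ 1 N) → QuantumTorus Λ :=
    Sum.elim (fun e => term Λ e 1 * f) (fun e => term Λ e 1 * g)
  have hdep : ¬ LinearIndependent ℤ[T;T⁻¹] v := by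
    intro hli
    have hle := linearIndependent_le_span' v hli
      (((box σ (1 - L) (N + L)).image fun e => term Λ e 1 : Finset (QuantumTorus Λ)) :
          Set (QuantumTorus Λ)) (by
        rintro _ ⟨e | e, rfl⟩
        · exact hmem f hf' e.1 e.2
        · exact hmem g hg' e.1 e.2)
    rw [Cardinal.mk_fintype, Nat.cast_le, Fintype.card_sum, Fintype.card_coe] at hle
    replace hle := hle.trans_eq (Fintype.card_coe _)
    have hle' := hle.trans Finset.card_image_le
    rw [card_box, card_box] at hle'
    have e1 : ((N : ℤ) + 1 - 1).toNat = N := by omega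
    have e2 : ((N : ℤ) + L + 1 - (1 - L)).toNat = N + 2 * L := by omega
    rw [e1, e2] at hle'
    omega
  rw [Fintype.linearIndependent_iff] at hdep
  push Not at hdep
  obtain ⟨c, hc, i, hi⟩ := hdep
  let w : (box σ 1 N → ℤ[T;T⁻¹]) → QuantumTorus Λ := fun a => ∑ e, term Λ e.1 (a e)
  have hw : ∀ a : box σ 1 N → ℤ[T;T⁻¹], w a = 0 → ∀ e, a e = 0 := by
    intro a ha e
    have h1 : coeff (w a) e.1 = 0 := by rw [ha]; rfl
    rw [coeff_sum, Finset.sum_eq_single e] at h1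
    · simpa [coeff_term] using h1
    · intro e' _ hne
      rw [coeff_term, if_neg fun h => hne (Subtype.ext h)]
    · simp
  have hterm : ∀ (a : box σ 1 N → ℤ[T;T⁻¹]) (h : QuantumTorus Λ),
      ∑ e, a e • (term Λ e.1 1 * h) = w a * h := by
    intro a h
    rw [Finset.sum_mul]
    refine Finset.sum_congr rfl fun e _ => ?_
    rw [← smul_mul', smul_term, mul_one]
  rw [Fintype.sum_sum_type] at hc
  simp only [v, Sum.elim_inl, Sum.elim_inr] at hc
  rw [hterm (fun e => c (Sum.inl e)) f, hterm (fun e => c (Sum.inr e)) g] at hc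
  have hc' : w (fun e => c (Sum.inl e)) * f = (-w (fun e => c (Sum.inr e))) * g := by
    rw [neg_mul]; exact eq_neg_of_add_eq_zero_left hc
  refine ⟨_, _, fun h0 => ?_, hc'⟩
  rw [h0, zero_mul, zero_add] at hc
  have h2 := (mul_eq_zero.1 hc).resolve_right hg
  rcases i with i | i
  · exact hi (hw _ h0 i)
  · exact hi (hw _ h2 i)

lemma nonempty_oreSet (Λ : Matrix σ σ ℤ) :
    Nonempty (OreLocalization.OreSet (QuantumTorus Λ)⁰) := by
  rw [OreLocalization.nonempty_oreSet_iff_of_noZeroDivisors]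
  intro f g
  obtain ⟨u, v, hv, h⟩ := ore f g.1 (nonZeroDivisors.coe_ne_zero g)
  exact ⟨u, ⟨v, mem_nonZeroDivisors_of_ne_zero hv⟩, h⟩

instance : OreLocalization.OreSet (QuantumTorus Λ)⁰ := (nonempty_oreSet Λ).some

end QuantumTorus

/-- The skew-field of fractions of the based quantum torus. -/
abbrev FractionSkewField (Λ : Matrix σ σ ℤ) : Type :=
  OreLocalization (QuantumTorus Λ)⁰ (QuantumTorus Λ)

/-- The canonical embedding of the quantum torus into its skew-field of fractions. -/
def toFrac (Λ : Matrix σ σ ℤ) : QuantumTorus Λ →+* FractionSkewField Λ :=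
  OreLocalization.numeratorRingHom

/-- `q^{s/2}` as an element of the skew-field. -/
def qHalf (Λ : Matrix σ σ ℤ) (s : ℤ) : FractionSkewField Λ :=
  toFrac Λ (QuantumTorus.term Λ 0 (LaurentPolynomial.T s))

end Torus

/-! ### The tree, mutations and classical cluster variables with principal coefficients

Extended clusters with principal coefficients have `2n` elements, indexed by `Fin n ⊕ Fin n`: the
left summand indexes `x_1, …, x_n`, the right summand the coefficient variables `y_1, …, y_n`. -/

/-- The vertices of the `n`-regular tree `𝕋_n`, whose edges are labelled by `Fin n`: a vertex `t` is
the sequence of the labels on the path from the initial vertex `t₀` to `t`, no two consecutive labels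
being equal. The last label is listed first, so `t₀` is `[]`, and if the first label of `t` is not
`k` then the edge labelled `k` at `t` leads to `k :: t`. -/
def TreeVertex (n : ℕ) : Type := {w : List (Fin n) // w.IsChain (· ≠ ·)}

variable {n : ℕ}

/-- Matrix mutation in direction `k`. -/
def mutateMatrix (k : Fin n) (b : Matrix (Fin n ⊕ Fin n) (Fin n) ℤ) :
    Matrix (Fin n ⊕ Fin n) (Fin n) ℤ :=
  fun i j => if i = Sum.inl k ∨ j = k then -b i j
    else b i j + (b i k).sign * max (b i k * b (Sum.inl k) j) 0

/-- The extended exchange matrix at a vertex of the tree. The one at the initial vertex is the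
principal matrix, with `B` on top of the identity matrix. -/
def exchangeMatrix (B : Matrix (Fin n) (Fin n) ℤ) :
    List (Fin n) → Matrix (Fin n ⊕ Fin n) (Fin n) ℤ
  | [] => Matrix.fromRows B 1
  | k :: w => mutateMatrix k (exchangeMatrix B w)

/-- The ambient field `ℚ(x_1, …, x_n, y_1, …, y_n)` of the classical cluster algebra. -/
abbrev ClassicalField (n : ℕ) : Type := FractionRing (MvPolynomial (Fin n ⊕ Fin n) ℤ)

/-- The initial extended cluster `x_1, …, x_n, y_1, …, y_n`. -/
def classicalVar (i : Fin n ⊕ Fin n) : ClassicalField n :=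
  algebraMap (MvPolynomial (Fin n ⊕ Fin n) ℤ) (ClassicalField n) (MvPolynomial.X i)

/-- The extended cluster at a vertex of the tree, for the classical cluster algebra with principal
coefficients at the initial vertex; recall that `(b : ℤ).toNat` is `max b 0`. -/
def classicalCluster (B : Matrix (Fin n) (Fin n) ℤ) :
    List (Fin n) → Fin n ⊕ Fin n → ClassicalField n
  | [] => classicalVar
  | k :: w =>
    let x := classicalCluster B w
    let b := exchangeMatrix B w
    Function.update x (Sum.inl k) ((x (Sum.inl k))⁻¹ *
      (∏ i, x i ^ (b i k).toNat + ∏ i, x i ^ (-b i k).toNat))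

/-- The homogeneous component of degree `g` of `ℤ[x_1^{±1}, …, x_n^{±1}, y_1^{±1}, …, y_n^{±1}]`,
for the `ℤ^n`-grading in which `x_i` has degree the `i`th unit vector and `y_j` has degree minus the
`j`th column of `B`. -/
def homogeneousComponent (B : Matrix (Fin n) (Fin n) ℤ) (g : Fin n → ℤ) :
    Submodule ℤ (ClassicalField n) :=
  Submodule.span ℤ {z | ∃ c : Fin n ⊕ Fin n → ℤ,
    (∀ i, c (Sum.inl i) - ∑ j, B i j * c (Sum.inr j) = g i) ∧ z = ∏ i, classicalVar i ^ c i}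

open Classical in
/-- The `g`-vector: the degree of the (non-zero, homogeneous) cluster variable `x_{j;t}` of the
classical cluster algebra with principal coefficients. -/
def gVector (B : Matrix (Fin n) (Fin n) ℤ) (t : TreeVertex n) (j : Fin n) : Fin n → ℤ :=
  if h : ∃ g, classicalCluster B t.1 (Sum.inl j) ∈ homogeneousComponent B g then h.choose else 0

/-! ### The quantum cluster algebra with principal coefficients -/

/-- The matrix of the quasi-commutation relations at the initial vertex: the unique skew-symmetric
matrix with upper left block `Λ` that is compatible with the principal matrix of `B`, for the
diagonal matrix `D` with entries `d`. -/
def initialForm (B : Matrix (Fin n) (Fin n) ℤ) (d : Fin n → ℤ) (Λ : Matrix (Fin n) (Fin n) ℤ) :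
    Matrix (Fin n ⊕ Fin n) (Fin n ⊕ Fin n) ℤ :=
  Matrix.fromBlocks Λ (-(Λ * B) - Matrix.diagonal d)
    (-(Bᵀ * Λ) + Matrix.diagonal d) (Bᵀ * Λ * B + Bᵀ * Matrix.diagonal d)

/-- The `t`-binomial coefficient
`((t^r - t^{-r}) ⋯ (t^{r-p+1} - t^{-r+p-1})) / ((t^p - t^{-p}) ⋯ (t - t^{-1}))`
(all factors are elements of the subfield generated by `t`). -/
def tBinomial {K : Type} [DivisionRing K] (t : K) (r p : ℕ) : K :=
  ((List.range p).map fun i : ℕ =>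
    (t ^ ((r : ℤ) - i) - t ^ (-((r : ℤ) - i))) / (t ^ ((i : ℤ) + 1) - t ^ (-((i : ℤ) + 1)))).prod

/-- The linear map of `ℤ^{2n}` that enters the mutation of toric frames in direction `k` (for the
sign `+`): it fixes the unit vector `e_i` for `i ≠ k` and sends `e_k` to
`-e_k + ∑_{i ≠ k} max(0, -b_{ik}) e_i`. -/
def mutationE (k : Fin n) (b : Matrix (Fin n ⊕ Fin n) (Fin n) ℤ) :
    Matrix (Fin n ⊕ Fin n) (Fin n ⊕ Fin n) ℤ :=
  fun i j => if j = Sum.inl k then (if i = Sum.inl k then -1 else max 0 (-b i k))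
    else if i = j then 1 else 0

/-- The toric frame at a vertex of the tree, for the quantum cluster algebra with principal
coefficients at the initial vertex. At the initial vertex it is `c ↦ X^c`; the frame `M'` obtained
from `M` by mutation in direction `k` is
`M'(c) = ∑_{0 ≤ p ≤ c_k} binom(c_k, p)_{q^{d_k/2}} M(E c + p b^k)` if `c_k ≥ 0`, and
`M'(c) = M'(-c)⁻¹` otherwise. -/
def toricFrame (B : Matrix (Fin n) (Fin n) ℤ) (d : Fin n → ℤ) (Λ : Matrix (Fin n) (Fin n) ℤ) :
    List (Fin n) → (Fin n ⊕ Fin n → ℤ) → FractionSkewField (initialForm B d Λ)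
  | [], c => toFrac _ (QuantumTorus.term _ c 1)
  | k :: w, c =>
    let b := exchangeMatrix B w
    let S : (Fin n ⊕ Fin n → ℤ) → FractionSkewField (initialForm B d Λ) := fun c =>
      ∑ p ∈ Finset.range ((c (Sum.inl k)).toNat + 1),
        tBinomial (qHalf _ (d k)) (c (Sum.inl k)).toNat p *
          toricFrame B d Λ w (mutationE k b *ᵥ c + (p : ℤ) • fun i => b i k)
    if 0 ≤ c (Sum.inl k) then S c else (S (-c))⁻¹

/-- The quantum cluster variable `X_{j;t}`. -/
def clusterVariable (B : Matrix (Fin n) (Fin n) ℤ) (d : Fin n → ℤ) (Λ : Matrix (Fin n) (Fin n) ℤ)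
    (t : TreeVertex n) (j : Fin n) : FractionSkewField (initialForm B d Λ) :=
  toricFrame B d Λ t.1 (Pi.single (Sum.inl j) 1)

/-- `Ŷ_j = M_0(b^j)`, where `b^j` is the `j`th column of the principal matrix of `B`. -/
def yHat (B : Matrix (Fin n) (Fin n) ℤ) (d : Fin n → ℤ) (Λ : Matrix (Fin n) (Fin n) ℤ)
    (j : Fin n) : FractionSkewField (initialForm B d Λ) :=
  toricFrame B d Λ [] fun i => exchangeMatrix B [] i j

/-- The algebra `R` of Laurent polynomials in `Z_1, …, Z_n` over `ℤ[q^{±1/2}]` with the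
quasi-commutation relations `Z_i Z_j = q^{d_i b_{ij}} Z_j Z_i`. It is a based quantum torus, its
distinguished basis being given by the normalized monomials
`Z^a = q^{(1/2) ∑_{i<j} d_j b_{ji} a_i a_j} Z_1^{a_1} ⋯ Z_n^{a_n}`. -/
abbrev ZTorus (B : Matrix (Fin n) (Fin n) ℤ) (d : Fin n → ℤ) : Type :=
  QuantumTorus (Matrix.diagonal d * B)

/-- The value of the monomial `Z^a` if each `Z_i` is set to `Ŷ_i`. -/
def yHatMonomial (B : Matrix (Fin n) (Fin n) ℤ) (d : Fin n → ℤ) (Λ : Matrix (Fin n) (Fin n) ℤ)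
    (a : Fin n → ℤ) : FractionSkewField (initialForm B d Λ) :=
  qHalf _ (∑ i, ∑ j, if i < j then d j * B j i * a i * a j else 0) *
    (List.ofFn fun i => yHat B d Λ i ^ a i).prod

/-- `F(Ŷ)`, the value of `F ∈ R` if each `Z_i` is set to `Ŷ_i`. -/
def evalYHat (B : Matrix (Fin n) (Fin n) ℤ) (d : Fin n → ℤ) (Λ : Matrix (Fin n) (Fin n) ℤ)
    (F : ZTorus B d) : FractionSkewField (initialForm B d Λ) :=
  ∑ a ∈ F.supp, toFrac _ (QuantumTorus.term _ 0 (F.coeff a)) * yHatMonomial B d Λ a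

/-- `F` is a polynomial in `Z_1, …, Z_n` with coefficients in `ℤ[q^{±1/2}]` and
`X_{j;t} = F(Ŷ) M_0(g_{j;t})`, the `g`-vector being extended by zeros. -/
def IsQuantumFPolynomial (B : Matrix (Fin n) (Fin n) ℤ) (d : Fin n → ℤ)
    (Λ : Matrix (Fin n) (Fin n) ℤ) (t : TreeVertex n) (j : Fin n) (F : ZTorus B d) : Prop :=
  (∀ a ∈ F.supp, ∀ i, 0 ≤ a i) ∧
    clusterVariable B d Λ t j =
      evalYHat B d Λ F * toricFrame B d Λ [] (Sum.elim (gVector B t j) 0)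

open Classical in
/-- The (left) quantum `F`-polynomial `F_{j;t}`: the unique polynomial `F` in `Z_1, …, Z_n` with
coefficients in `ℤ[q^{±1/2}]` such that `X_{j;t} = F(Ŷ) M_0(g_{j;t})`. -/
def quantumFPolynomial (B : Matrix (Fin n) (Fin n) ℤ) (d : Fin n → ℤ)
    (Λ : Matrix (Fin n) (Fin n) ℤ) (t : TreeVertex n) (j : Fin n) : ZTorus B d :=
  if h : ∃ F, IsQuantumFPolynomial B d Λ t j F then h.choose else 0

end QuantumCluster

end

/-! The bar involution of the initial quantum torus fixes every `X^e`, inverts `q^{1/2}` and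
reverses products. It is an anti-automorphism because the form is skew-symmetric, and it extends to
the skew-field of fractions (`fracBar`). Cluster variables are bar-invariant (`fracBar_toricFrame`):
a mutated frame element is a sum of quantum binomials times old frame elements, or the inverse of
such a sum. The binomials are central and unchanged under `t ↦ t⁻¹`, so invariance propagates along
the tree. On the other hand, `Z^a` specializes to `M₀(B̃ a)`, and compatibility gives `M₀(B̃ a)
M₀(g) = q^{(g·a·d)/2} M₀(B̃ a + g)`. Since `B̃` is injective, the coefficient of `M₀(B̃ a + g)` in
the cluster variable is exactly `q^{(g·a·d)/2} P_a(q^{1/2})`. Bar-invariance says that this Laurent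
polynomial is symmetric in `q^{1/2}`, which is the claim (`coeff_eq_of_fracBar_eq`). Of the
`g`-vector, only its role in the factorization `X = F(Ŷ) M₀(g)` matters. -/

noncomputable section

namespace QuantumCluster

section Bar

variable {σ : Type} [Fintype σ]

lemma form_swap {Λ : Matrix σ σ ℤ} (hΛ : Λᵀ = -Λ) (e f : σ → ℤ) : form Λ f e = -form Λ e f := by
  simp only [form, ← Finset.sum_neg_distrib]
  rw [Finset.sum_comm]
  refine Finset.sum_congr rfl fun i _ => Finset.sum_congr rfl fun j _ => ?_
  have h : Λ j i = -Λ i j := by simpa using congrFun (congrFun hΛ i) j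
  rw [h]
  ring

lemma form_self {Λ : Matrix σ σ ℤ} (hΛ : Λᵀ = -Λ) (e : σ → ℤ) : form Λ e e = 0 := by
  have h := form_swap hΛ e e
  omega

lemma form_eq_dotProduct (Λ : Matrix σ σ ℤ) (e f : σ → ℤ) : form Λ e f = (e ᵥ* Λ) ⬝ᵥ f := by
  simp only [form, dotProduct, Matrix.vecMul, Finset.sum_mul]
  exact Finset.sum_comm

/-! ### The bar involution of a based quantum torus. -/

namespace QuantumTorus

variable {Λ : Matrix σ σ ℤ}

lemma term_zero (e : σ → ℤ) : term Λ e 0 = 0 := Finsupp.single_zero e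

lemma one_def : (1 : QuantumTorus Λ) = term Λ 0 1 := rfl

lemma term_zero_commute (a : ℤ[T;T⁻¹]) (f : QuantumTorus Λ) : Commute (term Λ 0 a) f := by
  induction f using induction_terms with
  | h0 => exact Commute.zero_right _
  | hadd f g hf hg => exact hf.add_right hg
  | hterm e b =>
    simp only [Commute, SemiconjBy, term_mul_term, form_zero_left, form_zero_right, zero_add,
      add_zero, mul_assoc, mul_comm a b]

/-- The bar involution of the quantum torus as an additive map: it fixes each `X^e` and sends
`q^{1/2}` to `q^{-1/2}`. -/
def bar (Λ : Matrix σ σ ℤ) : QuantumTorus Λ →+ QuantumTorus Λ :=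
  Finsupp.mapRange.addMonoidHom
    (LaurentPolynomial.invert : ℤ[T;T⁻¹] ≃ₐ[ℤ] ℤ[T;T⁻¹]).toAlgHom.toRingHom.toAddMonoidHom

lemma bar_term (e : σ → ℤ) (a : ℤ[T;T⁻¹]) :
    bar Λ (term Λ e a) = term Λ e (LaurentPolynomial.invert a) :=
  Finsupp.mapRange_single (hf := map_zero (LaurentPolynomial.invert (R := ℤ)))

lemma coeff_bar (f : QuantumTorus Λ) (e : σ → ℤ) :
    coeff (bar Λ f) e = LaurentPolynomial.invert (coeff f e) := rfl

/-- Inverting `q^{1/2}` negates the exponent `Λ(e, e')`, and by skew-symmetry so does exchanging the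
two factors. -/
lemma bar_mul (hΛ : Λᵀ = -Λ) (f g : QuantumTorus Λ) : bar Λ (f * g) = bar Λ g * bar Λ f := by
  induction f using induction_terms with
  | h0 => simp
  | hadd f f' hf hf' => rw [add_mul, map_add, hf, hf', map_add, mul_add]
  | hterm e a =>
    induction g using induction_terms with
    | h0 => simp
    | hadd g g' hg hg' => rw [mul_add, map_add, hg, hg', map_add, add_mul]
    | hterm e' b =>
      simp only [term_mul_term, bar_term, map_mul, LaurentPolynomial.invert_T]
      rw [form_swap hΛ e e', add_comm e e']
      congr 1
      ring

/-- The bar involution is an anti-automorphism. -/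
def barOp (hΛ : Λᵀ = -Λ) : QuantumTorus Λ →+* (QuantumTorus Λ)ᵐᵒᵖ where
  toFun f := MulOpposite.op (bar Λ f)
  map_zero' := by simp
  map_add' f g := by simp
  map_one' := by rw [one_def, bar_term, map_one]; rfl
  map_mul' f g := by rw [bar_mul hΛ, MulOpposite.op_mul]

lemma bar_ne_zero {f : QuantumTorus Λ} (hf : f ≠ 0) : bar Λ f ≠ 0 := by
  refine fun h => hf (Finsupp.ext fun e => ?_)
  have h1 := coeff_bar f e
  rw [h] at h1
  exact (map_eq_zero_iff _ (LaurentPolynomial.invert (R := ℤ)).injective).1 h1.symm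

end QuantumTorus

/-! ### Scalars, monomials and the bar involution in the skew-field of fractions. -/

variable {Λ : Matrix σ σ ℤ}

open QuantumTorus

lemma toFrac_injective (Λ : Matrix σ σ ℤ) : Function.Injective (toFrac Λ) :=
  OreLocalization.numeratorHom_inj inf_le_left

lemma exists_eq_inv_mul (z : FractionSkewField Λ) :
    ∃ f g : QuantumTorus Λ, g ≠ 0 ∧ z = (toFrac Λ g)⁻¹ * toFrac Λ f := by
  induction z using OreLocalization.ind with | _ r s
  have hs : (s : QuantumTorus Λ) ≠ 0 := nonZeroDivisors.coe_ne_zero s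
  refine ⟨r, s, hs, ?_⟩
  rw [eq_inv_mul_iff_mul_eq₀ ((map_ne_zero_iff _ (toFrac_injective Λ)).2 hs)]
  exact OreLocalization.mul_cancel

lemma scalar_commute (a : ℤ[T;T⁻¹]) (z : FractionSkewField Λ) :
    Commute (toFrac Λ (term Λ 0 a)) z := by
  obtain ⟨f, g, -, rfl⟩ := exists_eq_inv_mul z
  exact (((term_zero_commute a g).map (toFrac Λ)).inv_right₀).mul_right
    ((term_zero_commute a f).map (toFrac Λ))

/-- The bar involution of the skew-field of fractions, as a homomorphism to the opposite ring. -/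
def fracBar (hΛ : Λᵀ = -Λ) : FractionSkewField Λ →+* (FractionSkewField Λ)ᵐᵒᵖ :=
  OreLocalization.universalHom ((toFrac Λ).op.comp (barOp hΛ))
    -- The universal property requires denominators to become units: the bar of a non-zero element
    -- is non-zero, hence invertible in the opposite skew-field.
    ((Units.liftRight (((toFrac Λ).op.comp (barOp hΛ)).toMonoidHom.comp (QuantumTorus Λ)⁰.subtype)
      (fun s => Units.mk0 (MulOpposite.op (toFrac Λ (bar Λ s)))
        ((MulOpposite.op_ne_zero_iff _).2 ((map_ne_zero_iff _ (toFrac_injective Λ)).2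
          (bar_ne_zero (nonZeroDivisors.coe_ne_zero s))))))
      fun _ => rfl)
    fun _ => rfl

lemma fracBar_toFrac (hΛ : Λᵀ = -Λ) (f : QuantumTorus Λ) :
    fracBar hΛ (toFrac Λ f) = MulOpposite.op (toFrac Λ (bar Λ f)) :=
  OreLocalization.universalHom_commutes _ _ _

lemma fracBar_monomial (hΛ : Λᵀ = -Λ) (e : σ → ℤ) :
    fracBar hΛ (toFrac Λ (term Λ e 1)) = MulOpposite.op (toFrac Λ (term Λ e 1)) := by
  rw [fracBar_toFrac, bar_term, map_one]

lemma toFrac_term_mul_term (e f : σ → ℤ) (a b : ℤ[T;T⁻¹]) :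
    toFrac Λ (term Λ e a) * toFrac Λ (term Λ f b) =
      toFrac Λ (term Λ (e + f) (LaurentPolynomial.T (form Λ e f) * a * b)) := by
  rw [← map_mul, term_mul_term]

lemma qHalf_mul_qHalf (r s : ℤ) : qHalf Λ r * qHalf Λ s = qHalf Λ (r + s) := by
  rw [qHalf, qHalf, toFrac_term_mul_term, form_zero_left, add_zero, LaurentPolynomial.T_zero,
    one_mul, ← LaurentPolynomial.T_add, qHalf]

lemma qHalf_zero : qHalf Λ 0 = 1 := map_one (toFrac Λ)

lemma qHalf_ne_zero (s : ℤ) : qHalf Λ s ≠ 0 := fun h => by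
  have h1 := qHalf_mul_qHalf (Λ := Λ) s (-s)
  rw [h, zero_mul, add_neg_cancel, qHalf_zero] at h1
  exact zero_ne_one h1

lemma inv_qHalf (s : ℤ) : (qHalf Λ s)⁻¹ = qHalf Λ (-s) := by
  rw [inv_eq_iff_eq_inv, ← mul_eq_one_iff_eq_inv₀ (qHalf_ne_zero _), qHalf_mul_qHalf,
    add_neg_cancel, qHalf_zero]

lemma qHalf_commute (s : ℤ) (z : FractionSkewField Λ) : Commute (qHalf Λ s) z :=
  scalar_commute _ z

lemma fracBar_qHalf (hΛ : Λᵀ = -Λ) (s : ℤ) :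
    fracBar hΛ (qHalf Λ s) = MulOpposite.op (qHalf Λ s)⁻¹ := by
  rw [inv_qHalf, qHalf, fracBar_toFrac, bar_term, LaurentPolynomial.invert_T, qHalf]

lemma toFrac_monomial_zpow (hΛ : Λᵀ = -Λ) (e : σ → ℤ) (m : ℤ) :
    toFrac Λ (term Λ e 1) ^ m = toFrac Λ (term Λ (m • e) 1) := by
  have hadd : ∀ r s : ℤ, toFrac Λ (term Λ (r • e) 1) * toFrac Λ (term Λ (s • e) 1) =
      toFrac Λ (term Λ ((r + s) • e) 1) := by
    intro r s
    -- Multiples of one exponent have form zero, so their monomials multiply without a power of `q`.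
    have h : form Λ (r • e) (s • e) = 0 := by
      have : form Λ (r • e) (s • e) = r * s * form Λ e e := by
        simp only [form, Finset.mul_sum, Pi.smul_apply, smul_eq_mul]
        exact Finset.sum_congr rfl fun i _ => Finset.sum_congr rfl fun j _ => by ring
      rw [this, form_self hΛ, mul_zero]
    rw [toFrac_term_mul_term, h, add_smul, LaurentPolynomial.T_zero, mul_one, mul_one]
  have hone : toFrac Λ (term Λ ((0 : ℤ) • e) 1) = 1 := by
    rw [zero_smul]; exact map_one (toFrac Λ)
  have hnat : ∀ k : ℕ, toFrac Λ (term Λ e 1) ^ k = toFrac Λ (term Λ ((k : ℤ) • e) 1) := by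
    intro k
    induction k with
    | zero => rw [pow_zero, Nat.cast_zero, hone]
    | succ k ih =>
      have h1 := hadd k 1
      rw [one_smul] at h1
      rw [pow_succ, ih, h1, Nat.cast_succ]
  obtain ⟨k, rfl | rfl⟩ := m.eq_nat_or_neg
  · rw [zpow_natCast, hnat]
  · rw [zpow_neg, zpow_natCast, hnat]
    refine (eq_inv_of_mul_eq_one_left ?_).symm
    rw [hadd, neg_add_cancel, hone]

/-- An ordered product of normalized monomials. -/
lemma prod_ofFn_monomial {m : ℕ} (v : Fin m → σ → ℤ) :
    (List.ofFn fun i => toFrac Λ (term Λ (v i) 1)).prod =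
      qHalf Λ (∑ i, ∑ j, if i < j then form Λ (v i) (v j) else 0) *
        toFrac Λ (term Λ (∑ i, v i) 1) := by
  induction m with
  | zero =>
    simp only [List.ofFn_zero, List.prod_nil, Finset.univ_eq_empty, Finset.sum_empty, qHalf_zero,
      one_mul]
    exact (map_one (toFrac Λ)).symm
  | succ m ih =>
    have hform : ∀ (e : σ → ℤ) (s : Finset (Fin m)) (u : Fin m → σ → ℤ),
        form Λ e (∑ i ∈ s, u i) = ∑ i ∈ s, form Λ e (u i) := fun e s u =>
      map_sum (AddMonoidHom.mk' (form Λ e) (form_add_right Λ e)) u s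
    -- The power of `q` from the tail is central and moves to the front; multiplying the first
    -- monomial into the normalized tail then contributes the pairs `(0, j)`.
    rw [List.ofFn_succ, List.prod_cons, ih fun i => v i.succ, ← mul_assoc,
      ← (qHalf_commute _ _).eq, mul_assoc, toFrac_term_mul_term, hform]
    simp only [Fin.sum_univ_succ, Fin.succ_pos, Fin.succ_lt_succ_iff, Fin.not_lt_zero, if_true,
      if_false, zero_add]
    simp only [qHalf, toFrac_term_mul_term, form_zero_left, zero_add, mul_one,
      LaurentPolynomial.T_zero, one_mul, ← LaurentPolynomial.T_add]
    rw [add_comm (∑ i : Fin m, form Λ (v 0) (v i.succ))]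

end Bar

/-- Quantum binomial coefficients are fixed by an anti-homomorphism that inverts `t`. -/
lemma map_tBinomial {K : Type} [DivisionRing K] (φ : K →+* Kᵐᵒᵖ) {t : K}
    (ht : φ t = MulOpposite.op t⁻¹) (r p : ℕ) :
    φ (tBinomial t r p) = MulOpposite.op (tBinomial t r p) := by
  have hcomm : ∀ s u : ℤ, Commute (t ^ s - t ^ (-s)) (t ^ u - t ^ (-u)) := fun s u => by
    have h : ∀ a b : ℤ, Commute (t ^ a) (t ^ b) := fun a b =>
      (Commute.refl t).zpow_zpow₀ a b
    exact ((h _ _).sub_right (h _ _)).sub_left ((h _ _).sub_right (h _ _))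
  -- Each factor only changes sign, so in every quotient the signs of numerator and denominator
  -- cancel; commutativity makes the reversal of products harmless.
  have hmap : ∀ s : ℤ, φ (t ^ s - t ^ (-s)) = MulOpposite.op (-(t ^ s - t ^ (-s))) := fun s => by
    rw [map_sub, map_zpow₀, map_zpow₀, ht, ← MulOpposite.op_zpow, ← MulOpposite.op_zpow,
      ← MulOpposite.op_sub, inv_zpow', inv_zpow', neg_neg, neg_sub]
  have hdiv : ∀ s u : ℤ, φ ((t ^ s - t ^ (-s)) / (t ^ u - t ^ (-u))) =
      MulOpposite.op ((t ^ s - t ^ (-s)) / (t ^ u - t ^ (-u))) := fun s u => by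
    rw [map_div₀, hmap, hmap, div_eq_mul_inv, ← MulOpposite.op_inv, ← MulOpposite.op_mul, inv_neg,
      neg_mul_neg, div_eq_mul_inv, ((hcomm s u).inv_right₀).eq]
  unfold tBinomial
  induction p with
  | zero => simp
  | succ p ih =>
    rw [List.range_succ, List.map_append, List.prod_append, List.map_singleton,
      List.prod_singleton, map_mul, ih, hdiv, ← MulOpposite.op_mul]
    congr 1
    refine (Commute.list_prod_left _ _ fun x hx => ?_).eq.symm
    obtain ⟨i, -, rfl⟩ := List.mem_map.1 hx
    have hc : ∀ a b c e : ℤ, Commute ((t ^ a - t ^ (-a)) / (t ^ b - t ^ (-b)))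
        ((t ^ c - t ^ (-c)) / (t ^ e - t ^ (-e))) := fun a b c e =>
      ((hcomm a c).div_right (hcomm a e)).div_left ((hcomm b c).div_right (hcomm b e))
    exact hc _ _ _ _

lemma tBinomial_commute {K : Type} [DivisionRing K] {t z : K} (h : Commute t z) (r p : ℕ) :
    Commute (tBinomial t r p) z := by
  refine Commute.list_prod_left _ _ fun x hx => ?_
  obtain ⟨i, -, rfl⟩ := List.mem_map.1 hx
  exact Commute.div_left ((h.zpow_left₀ _).sub_left (h.zpow_left₀ _))
    ((h.zpow_left₀ _).sub_left (h.zpow_left₀ _))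

/-! ### Principal coefficients: compatibility, invariance of toric frames, and expansion of `F(Ŷ)
M₀(g)`. -/

section Principal

variable {n : ℕ} {B : Matrix (Fin n) (Fin n) ℤ} {d : Fin n → ℤ} {Λ : Matrix (Fin n) (Fin n) ℤ}

lemma diagonal_mul_eq (hB : ∀ i j, d i * B i j = -(d j * B j i)) :
    Matrix.diagonal d * B = -(Bᵀ * Matrix.diagonal d) := by
  ext i j
  rw [Matrix.neg_apply, Matrix.diagonal_mul, Matrix.mul_diagonal, Matrix.transpose_apply, hB]
  ring

/-- The off-diagonal blocks match by skew-symmetry of `Λ`; skew-symmetry of `DB` is needed for the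
summand `Bᵀ D` of the lower right block. -/
lemma initialForm_transpose (hB : ∀ i j, d i * B i j = -(d j * B j i)) (hΛ : Λᵀ = -Λ) :
    (initialForm B d Λ)ᵀ = -initialForm B d Λ := by
  rw [initialForm, Matrix.fromBlocks_transpose, Matrix.fromBlocks_neg]
  simp only [Matrix.transpose_add, Matrix.transpose_neg, Matrix.transpose_sub,
    Matrix.transpose_mul, Matrix.transpose_transpose, Matrix.diagonal_transpose, hΛ,
    diagonal_mul_eq hB, Matrix.mul_assoc, Matrix.neg_mul, Matrix.mul_neg]
  congr 1 <;> abel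

/-- The compatibility condition `B̃ᵀ Λ₀ = (D | 0)`, applied to a vector `a`. -/
lemma vecMul_initialForm (a : Fin n → ℤ) :
    (Matrix.fromRows B 1 *ᵥ a) ᵥ* initialForm B d Λ = Sum.elim (fun i => a i * d i) 0 := by
  have h : (Matrix.fromRows B (1 : Matrix (Fin n) (Fin n) ℤ))ᵀ * initialForm B d Λ =
      Matrix.fromCols (Matrix.diagonal d) 0 := by
    rw [initialForm, Matrix.transpose_fromRows, Matrix.fromCols_mul_fromBlocks,
      Matrix.transpose_one, Matrix.one_mul, Matrix.one_mul]
    congr 1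
    · abel
    · rw [Matrix.mul_sub, Matrix.mul_neg, Matrix.mul_assoc]; abel
  rw [← Matrix.vecMul_transpose, Matrix.vecMul_vecMul, h, Matrix.vecMul_fromCols,
    Matrix.vecMul_zero]
  congr 1
  ext i
  rw [Matrix.vecMul_diagonal]

/-- This is the source of the exponent `g·a·d`: take for `c` the `g`-vector extended by zeros. -/
lemma form_initialForm (a : Fin n → ℤ) (c : Fin n ⊕ Fin n → ℤ) :
    form (initialForm B d Λ) (Matrix.fromRows B 1 *ᵥ a) c = ∑ i, a i * d i * c (Sum.inl i) := by
  rw [form_eq_dotProduct, vecMul_initialForm]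
  simp [dotProduct]

/-- Toric frames consist of bar-invariant elements. -/
lemma fracBar_toricFrame (hΛ : (initialForm B d Λ)ᵀ = -initialForm B d Λ) (w : List (Fin n))
    (c : Fin n ⊕ Fin n → ℤ) :
    fracBar hΛ (toricFrame B d Λ w c) = MulOpposite.op (toricFrame B d Λ w c) := by
  -- All `c` are needed, not just unit vectors: mutation evaluates the previous frame at `E c + p
  -- b^k`.
  induction w generalizing c with
  | nil => exact fracBar_monomial hΛ c
  | cons k w ih =>
    have hS : ∀ c : Fin n ⊕ Fin n → ℤ,
        fracBar hΛ (∑ p ∈ Finset.range ((c (Sum.inl k)).toNat + 1),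
          tBinomial (qHalf _ (d k)) (c (Sum.inl k)).toNat p *
            toricFrame B d Λ w (mutationE k (exchangeMatrix B w) *ᵥ c +
              (p : ℤ) • fun i => exchangeMatrix B w i k)) =
        MulOpposite.op (∑ p ∈ Finset.range ((c (Sum.inl k)).toNat + 1),
          tBinomial (qHalf _ (d k)) (c (Sum.inl k)).toNat p *
            toricFrame B d Λ w (mutationE k (exchangeMatrix B w) *ᵥ c +
              (p : ℤ) • fun i => exchangeMatrix B w i k)) := by
      intro c
      rw [map_sum, Finset.op_sum]
      refine Finset.sum_congr rfl fun p _ => ?_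
      -- The reversed product is restored because the binomial, built from the central `q^{d_k/2}`,
      -- is central.
      rw [map_mul, ih, map_tBinomial _ (fracBar_qHalf hΛ _), ← MulOpposite.op_mul,
        (tBinomial_commute (qHalf_commute _ _) _ _).eq]
    rw [toricFrame]
    split_ifs
    · exact hS c
    · rw [map_inv₀, hS, MulOpposite.op_inv]

lemma yHat_eq (j : Fin n) : yHat B d Λ j =
    toFrac _ (QuantumTorus.term _ (Matrix.fromRows B 1 *ᵥ Pi.single j 1) 1) := by
  rw [Matrix.mulVec_single_one]; rfl

/-- The monomial `Z^a` specializes to `M₀(B̃ a)`. -/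
lemma yHatMonomial_eq (hB : ∀ i j, d i * B i j = -(d j * B j i)) (hΛ : Λᵀ = -Λ)
    (a : Fin n → ℤ) :
    yHatMonomial B d Λ a = toFrac _ (QuantumTorus.term _ (Matrix.fromRows B 1 *ᵥ a) 1) := by
  have hpow : ∀ i, yHat B d Λ i ^ a i =
      toFrac _ (QuantumTorus.term _ (Matrix.fromRows B 1 *ᵥ Pi.single i (a i)) 1) := by
    intro i
    rw [yHat_eq, toFrac_monomial_zpow (initialForm_transpose hB hΛ), ← Matrix.mulVec_smul,
      ← Pi.single_smul, smul_eq_mul, mul_one]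
  -- Summed over `i < j`, these exponents are the negatives of those in the normalization of `Z^a`,
  -- so the two powers of `q` cancel.
  have hform : ∀ i j, form (initialForm B d Λ) (Matrix.fromRows B 1 *ᵥ Pi.single i (a i))
      (Matrix.fromRows B 1 *ᵥ Pi.single j (a j)) = -(d j * B j i * a i * a j) := by
    intro i j
    rw [form_initialForm, Finset.sum_eq_single i]
    · rw [Pi.single_eq_same, Matrix.fromRows_mulVec, Sum.elim_inl, Matrix.mulVec_single,
        Pi.smul_apply, Matrix.col_apply, op_smul_eq_mul]
      linear_combination a i * a j * hB i j
    · intro k _ hk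
      rw [Pi.single_eq_of_ne hk, zero_mul, zero_mul]
    · simp
  have hsum : ∑ i, Matrix.fromRows B 1 *ᵥ Pi.single i (a i) =
      (Matrix.fromRows B 1 : Matrix (Fin n ⊕ Fin n) (Fin n) ℤ) *ᵥ a := by
    rw [← Matrix.mulVec_sum, Finset.univ_sum_single]
  simp only [yHatMonomial, hpow]
  rw [prod_ofFn_monomial, hsum, ← mul_assoc, qHalf_mul_qHalf, ← Finset.sum_add_distrib]
  simp only [hform, ← Finset.sum_add_distrib]
  rw [Finset.sum_eq_zero, qHalf_zero, one_mul]
  intro i _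
  refine Finset.sum_eq_zero fun j _ => ?_
  split_ifs <;> ring

/-- The expansion of `F(Ŷ) M₀(g, 0)` in the initial quantum torus. -/
lemma evalYHat_mul_eq (hB : ∀ i j, d i * B i j = -(d j * B j i)) (hΛ : Λᵀ = -Λ)
    (F : ZTorus B d) (g : Fin n → ℤ) :
    evalYHat B d Λ F * toricFrame B d Λ [] (Sum.elim g 0) =
      toFrac _ (∑ a ∈ F.supp, QuantumTorus.term (initialForm B d Λ)
        (Matrix.fromRows B 1 *ᵥ a + Sum.elim g 0)
        (LaurentPolynomial.T (∑ i, g i * a i * d i) * F.coeff a)) := by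
  rw [evalYHat, Finset.sum_mul, map_sum]
  refine Finset.sum_congr rfl fun a _ => ?_
  rw [yHatMonomial_eq hB hΛ, toricFrame, toFrac_term_mul_term, toFrac_term_mul_term,
    form_zero_left, zero_add, form_initialForm, LaurentPolynomial.T_zero, one_mul, mul_one,
    mul_one]
  congr 6
  funext i
  rw [Sum.elim_inl]
  ring

/-- The identity block recovers `a`; hence distinct monomials of `F` cannot merge in the initial
torus. -/
lemma principal_mulVec_injective (B : Matrix (Fin n) (Fin n) ℤ) :
    Function.Injective fun a : Fin n → ℤ =>
      (Matrix.fromRows B 1 : Matrix (Fin n ⊕ Fin n) (Fin n) ℤ) *ᵥ a := by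
  intro a a' h
  ext i
  simpa [Matrix.fromRows_mulVec] using congrFun h (Sum.inr i)

/-- If `F(Ŷ) M₀(g, 0)` is bar-invariant, then so are the coefficients of `F` up to the shift
`q^{g · a · d}`. -/
lemma coeff_eq_of_fracBar_eq (hB : ∀ i j, d i * B i j = -(d j * B j i)) (hΛ : Λᵀ = -Λ)
    {F : ZTorus B d} {g : Fin n → ℤ} {X : FractionSkewField (initialForm B d Λ)}
    (hbar : fracBar (initialForm_transpose hB hΛ) X = MulOpposite.op X)
    (hX : X = evalYHat B d Λ F * toricFrame B d Λ [] (Sum.elim g 0)) (a : Fin n → ℤ) :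
    F.coeff a = LaurentPolynomial.T (2 * (-∑ i, g i * a i * d i)) *
      LaurentPolynomial.invert (F.coeff a) := by
  classical
  rw [evalYHat_mul_eq hB hΛ] at hX
  have hcoeff : ∀ a, QuantumTorus.coeff (∑ a ∈ F.supp, QuantumTorus.term (initialForm B d Λ)
      (Matrix.fromRows B 1 *ᵥ a + Sum.elim g 0)
      (LaurentPolynomial.T (∑ i, g i * a i * d i) * F.coeff a))
      (Matrix.fromRows B 1 *ᵥ a + Sum.elim g 0) =
      LaurentPolynomial.T (∑ i, g i * a i * d i) * F.coeff a := by
    intro a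
    rw [QuantumTorus.coeff_sum, Finset.sum_eq_single a]
    · rw [QuantumTorus.coeff_term, if_pos rfl]
    · intro a' _ hne
      rw [QuantumTorus.coeff_term,
        if_neg fun h => hne (principal_mulVec_injective B (add_right_cancel h))]
    · intro ha
      rw [QuantumTorus.mem_supp, not_not] at ha
      rw [ha, mul_zero, QuantumTorus.term_zero]
      rfl
  rw [hX, fracBar_toFrac] at hbar
  have h := congrArg (fun f => QuantumTorus.coeff f (Matrix.fromRows B 1 *ᵥ a + Sum.elim g 0))
    (toFrac_injective _ (MulOpposite.op_injective hbar))
  simp only [QuantumTorus.coeff_bar, hcoeff, map_mul, LaurentPolynomial.invert_T] at h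
  -- At this point `h` equates the shifted coefficient with its image under `invert`; removing the
  -- shift from the left doubles it on the right.
  calc
    F.coeff a = LaurentPolynomial.T (-∑ i, g i * a i * d i) *
        (LaurentPolynomial.T (∑ i, g i * a i * d i) * F.coeff a) := by
      rw [← mul_assoc, ← LaurentPolynomial.T_add, neg_add_cancel, LaurentPolynomial.T_zero, one_mul]
    _ = _ := by rw [← h, ← mul_assoc, ← LaurentPolynomial.T_add, two_mul]

end Principal

end QuantumCluster

end

/-! ### The symmetry of the coefficients of the quantum `F`-polynomial. -/

theorem mainTheorem6 {n : ℕ} (B : Matrix (Fin n) (Fin n) ℤ) (d : Fin n → ℤ)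
    (hd : ∀ i, 0 < d i) (hB : ∀ i j, d i * B i j = -(d j * B j i))
    (Λ : Matrix (Fin n) (Fin n) ℤ) (hΛ : Λᵀ = -Λ)
    (t : QuantumCluster.TreeVertex n) (j : Fin n) (a : Fin n → ℤ) :
    (QuantumCluster.quantumFPolynomial B d Λ t j).coeff a =
        LaurentPolynomial.T (2 * (-∑ i, QuantumCluster.gVector B t j i * a i * d i)) *
          LaurentPolynomial.invert ((QuantumCluster.quantumFPolynomial B d Λ t j).coeff a) ∧
      ∀ s : ℤ, (QuantumCluster.quantumFPolynomial B d Λ t j).coeff a = LaurentPolynomial.T s →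
        (s / 2 : ℚ) = -(∑ i, QuantumCluster.gVector B t j i * a i * d i : ℤ) / 2 := by
  have key : (QuantumCluster.quantumFPolynomial B d Λ t j).coeff a =
      LaurentPolynomial.T (2 * (-∑ i, QuantumCluster.gVector B t j i * a i * d i)) *
        LaurentPolynomial.invert ((QuantumCluster.quantumFPolynomial B d Λ t j).coeff a) := by
    by_cases h : ∃ F, QuantumCluster.IsQuantumFPolynomial B d Λ t j F
    · rw [QuantumCluster.quantumFPolynomial, dif_pos h]
      exact QuantumCluster.coeff_eq_of_fracBar_eq hB hΛ
        (QuantumCluster.fracBar_toricFrame _ t.1 _) h.choose_spec.2 a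
    -- Here the default value `0` satisfies the symmetry trivially, so existence of the
    -- `F`-polynomial need not be proved.
    · rw [QuantumCluster.quantumFPolynomial, dif_neg h]
      have h0 : (0 : QuantumCluster.ZTorus B d).coeff a = 0 := rfl
      rw [h0, map_zero, mul_zero]
  refine ⟨key, fun s hs => ?_⟩
  rw [hs, LaurentPolynomial.invert_T, ← LaurentPolynomial.T_add] at key
  have hT : Function.Injective (LaurentPolynomial.T : ℤ → ℤ[T;T⁻¹]) :=
    fun r s h => by
      have h1 := congrArg LaurentPolynomial.degree h
      simpa [LaurentPolynomial.degree_T] using h1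
  -- Comparing exponents of `T` gives `s = -2 (g·a·d) - s`.
  have hz : s = -∑ i, QuantumCluster.gVector B t j i * a i * d i := by
    have h2 := hT key
    omega
  rw [hz, Int.cast_neg]
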